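/- \textsc{bipass} is the following two-player game. A strip is a finite row of black and white stones. A move on a strip interchanges a black stone with a white stone lying (not necessarily adjacently) to its right; Left may do so only if there is no black stone strictly between the two, and Right may do so only if there is no white stone strictly between the two. A position is a disjunctive sum of finitely many strips: the player to move chooses one strip and moves on it. Play is under the normal-play convention (a player who cannot move loses). Two finite games $G$ and $H$ have the same value, $G\equiv H$, if for every finite game $X$ the sums $G+X$ and $H+X$ have the same outcome (Left wins, Right wins, the next player wins, or the previous player wins). Let $0=\{\,\mid\,\}$, $*=\{0\mid 0\}$ and $*2=\{0,*\mid 0,*\}$. \textbf{Theorem.} No \textsc{bipass} position has value $*2$: if $s_1,\dots,s_n$ ($n\ge 0$) are strips, then $s_1+\cdots+s_n\not\equiv *2$. -/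

import Mathlib

namespace Bipass

/-! ### Normal-play games -/

/-- Finite (short) partizan combinatorial games: a game is given by a finite family of Left options
and a finite family of Right options, and every line of play ends. -/
inductive Game : Type 1
  | mk (α β : Type) [Finite α] [Finite β] (L : α → Game) (R : β → Game) : Game

/-- The two players. -/
inductive Player
  | left
  | right

namespace Game

/-- `MoverWins G p`: under normal play (a player who cannot move loses), player `p` wins `G` when
`p` moves first. -/
def MoverWins : Game → Player → Prop
  | mk _ _ L _, .left => ∃ i, ¬ MoverWins (L i) .right
  | mk _ _ _ R, .right => ∃ j, ¬ MoverWins (R j) .left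

/-- The four outcome classes: Left wins, the next player wins, the previous player wins,
Right wins. -/
inductive Outcome
  | L
  | N
  | P
  | R

open Classical in
/-- The normal-play outcome of a game. -/
noncomputable def outcome (G : Game) : Outcome :=
  if G.MoverWins .left then
    if G.MoverWins .right then .N else .L
  else
    if G.MoverWins .right then .R else .P

/-- The recursion on the second summand in the definition of `add`: `f i` and `g j` are the maps
"add the `i`-th Left option (the `j`-th Right option) of the first summand". -/
def addAux {α β : Type} [Finite α] [Finite β] (f : α → Game → Game) (g : β → Game → Game) :
    Game → Game
  | mk γ δ L' R' =>
    mk (α ⊕ γ) (β ⊕ δ)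
      (Sum.elim (fun i => f i (mk γ δ L' R')) (fun k => addAux f g (L' k)))
      (Sum.elim (fun j => g j (mk γ δ L' R')) (fun l => addAux f g (R' l)))

/-- The disjunctive sum: the player to move moves in exactly one of the two components; see
`mk_add_mk` for the recursion that it satisfies. -/
def add : Game → Game → Game
  | mk _ _ L R => addAux (fun i => add (L i)) (fun j => add (R j))

instance : Add Game := ⟨add⟩

theorem mk_add_mk {α β γ δ : Type} [Finite α] [Finite β] [Finite γ] [Finite δ]
    (L : α → Game) (R : β → Game) (L' : γ → Game) (R' : δ → Game) :
    mk α β L R + mk γ δ L' R' =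
      mk (α ⊕ γ) (β ⊕ δ)
        (Sum.elim (fun i => L i + mk γ δ L' R') (fun k => mk α β L R + L' k))
        (Sum.elim (fun j => R j + mk γ δ L' R') (fun l => mk α β L R + R' l)) :=
  rfl

/-- Equality of game values: `G` and `H` have the same outcome in every disjunctive sum. -/
def Equivalent (G H : Game) : Prop :=
  ∀ X : Game, outcome (G + X) = outcome (H + X)

/-- The game `0 = { | }`. -/
def zero : Game := mk Empty Empty Empty.elim Empty.elim

/-- The nimber `* = {0 | 0}`. -/
def star : Game := mk Unit Unit (fun _ => zero) (fun _ => zero)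

/-- The nimber `*2 = {0, * | 0, *}`. -/
def starTwo : Game := mk Bool Bool (fun b => cond b star zero) (fun b => cond b star zero)

end Game

/-! ### The ruleset -/

/-- The stones; black stones are Left's and white stones are Right's. -/
inductive Stone
  | black
  | white

instance : Finite Stone :=
  Finite.of_surjective (fun b : Bool => cond b Stone.black Stone.white) fun
    | .black => ⟨true, rfl⟩
    | .white => ⟨false, rfl⟩

/-- A strip: a finite row of stones, read from left to right. -/
abbrev Strip := List Stone

open Stone in
/-- A Left move interchanges a black stone with a white stone to its right, provided that there is
no black stone between them. -/
def LeftMove (s t : Strip) : Prop :=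
  ∃ u m v : Strip, black ∉ m ∧
    s = u ++ black :: (m ++ white :: v) ∧ t = u ++ white :: (m ++ black :: v)

open Stone in
/-- A Right move interchanges a black stone with a white stone to its right, provided that there is
no white stone between them. -/
def RightMove (s t : Strip) : Prop :=
  ∃ u m v : Strip, white ∉ m ∧
    s = u ++ black :: (m ++ white :: v) ∧ t = u ++ white :: (m ++ black :: v)

/-- The sum, over all black stones of a strip, of the number of stones to the right of it; used only
to see that play ends. -/
def weight : Strip → ℕ
  | [] => 0
  | .black :: s => s.length + weight s
  | .white :: s => weight s

theorem weight_append_white_black (m v : Strip) :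
    weight (m ++ .black :: v) = weight (m ++ .white :: v) + v.length := by
  induction m with
  | nil => simp [weight]; omega
  | cons c m ih => cases c <;> (simp [weight, ih]; try omega)

theorem weight_swap (u m v : Strip) :
    weight (u ++ .white :: (m ++ .black :: v)) < weight (u ++ .black :: (m ++ .white :: v)) := by
  induction u with
  | nil => simp [weight, weight_append_white_black]; omega
  | cons c u ih => cases c <;> simp [weight] at ih ⊢ <;> omega

theorem LeftMove.weight_lt {s t : Strip} (h : LeftMove s t) : weight t < weight s := by
  obtain ⟨u, m, v, -, rfl, rfl⟩ := h
  exact weight_swap u m v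

theorem RightMove.weight_lt {s t : Strip} (h : RightMove s t) : weight t < weight s := by
  obtain ⟨u, m, v, -, rfl, rfl⟩ := h
  exact weight_swap u m v

instance (s : Strip) : Finite {t // LeftMove s t} := by
  refine Set.Finite.subset (List.finite_length_eq Stone s.length) ?_
  rintro t ⟨u, m, v, -, rfl, rfl⟩
  simp

instance (s : Strip) : Finite {t // RightMove s t} := by
  refine Set.Finite.subset (List.finite_length_eq Stone s.length) ?_
  rintro t ⟨u, m, v, -, rfl, rfl⟩
  simp

/-- The game played on a single strip. Stones that can no longer take part in any move (white stones
with no black stone to their left, black stones with no white stone to their right) are left in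
place; this does not change the moves. -/
def stripGame (s : Strip) : Game :=
  .mk {t // LeftMove s t} {t // RightMove s t}
    (fun t => stripGame t.1) (fun t => stripGame t.1)
termination_by weight s
decreasing_by
  · exact t.2.weight_lt
  · exact t.2.weight_lt

/-- The game of a position, a finite collection of strips: the disjunctive sum of its strips (the
empty collection gives `0`). -/
def positionGame (p : List Strip) : Game :=
  p.foldr (fun s G => stripGame s + G) Game.zero

end Bipass

/-! If a position `p` had value `*2`, then `p + *2` would be a previous-player win, like `*2 + *2`.
Instead, Left wins `p + *2` moving first whenever `p` has at most as many rows as columns, and by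
conjugation (`flip`) Right does in the opposite case. For Left, let the lead be columns minus rows.
Right lowers the lead by at most one per move. While some strip has two rows, Left deletes a
shortest row of it, gaining one. Once every strip has at most one row (`Thin`), Right removes
exactly one cell per move while Left may remove any number from a row, so Left only has to fix a
parity. Left does so with `*2` (`Thin.firstWins_two`), or, once `*2` is spent, with a row of length
at least two, which a positive lead supplies (`Thin.firstWins_of_lt`). The induction is
`wins_of_lead`. -/

namespace Bipass

/-! ### Options of sums -/

/-- The opponent of a player. -/
def Player.other : Player → Player
  | .left => .right
  | .right => .left

@[simp] theorem Player.other_other (P : Player) : P.other.other = P := by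
  cases P <;> rfl

namespace Game

/-- `IsOption P G H`: player `P` can move from `G` to `H`. -/
def IsOption : Player → Game → Game → Prop
  | .left, mk _ _ L _, H => ∃ i, H = L i
  | .right, mk _ _ _ R, H => ∃ j, H = R j

theorem moverWins_iff (P : Player) (G : Game) :
    G.MoverWins P ↔ ∃ H, IsOption P G H ∧ ¬ H.MoverWins P.other := by
  cases G
  cases P <;> simp [MoverWins, IsOption, Player.other]

theorem isOption_add (P : Player) (G K X : Game) :
    IsOption P (G + K) X ↔
      (∃ H, IsOption P G H ∧ X = H + K) ∨ ∃ H, IsOption P K H ∧ X = G + H := by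
  cases G
  cases K
  cases P <;> simp [mk_add_mk, IsOption]

/-- The nimbers `0`, `*` and `*2`. -/
def smallNimber : ℕ → Game
  | 0 => zero
  | 1 => star
  | _ => starTwo

theorem isOption_smallNimber (P : Player) {n : ℕ} (hn : n ≤ 2) (X : Game) :
    IsOption P (smallNimber n) X ↔ ∃ k < n, X = smallNimber k := by
  interval_cases n
  · cases P <;> simp [smallNimber, zero, IsOption]
  · cases P <;> simp [smallNimber, star, IsOption]
  · have h : (∃ k < 2, X = smallNimber k) ↔ X = star ∨ X = zero := by
      constructor
      · rintro ⟨k, hk, rfl⟩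
        interval_cases k
        · exact Or.inr rfl
        · exact Or.inl rfl
      · rintro (rfl | rfl)
        · exact ⟨1, by omega, rfl⟩
        · exact ⟨0, by omega, rfl⟩
    rw [h]
    cases P <;> simp [smallNimber, starTwo, IsOption, or_comm]

/-- The second player copies each move in the other summand. -/
theorem not_moverWins_smallNimber_add_self (P : Player) {n : ℕ} (hn : n ≤ 2) :
    ¬ (smallNimber n + smallNimber n).MoverWins P := by
  induction n using Nat.strong_induction_on generalizing P with
  | _ n ih =>
    rw [moverWins_iff]
    rintro ⟨X, hX, hw⟩
    apply hw
    rw [moverWins_iff, Player.other_other]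
    rw [isOption_add] at hX
    rcases hX with ⟨H, hH, rfl⟩ | ⟨H, hH, rfl⟩ <;>
      obtain ⟨k, hk, rfl⟩ := (isOption_smallNimber P hn H).1 hH <;>
      refine ⟨smallNimber k + smallNimber k, ?_, ih k hk P (by omega)⟩ <;>
      rw [isOption_add]
    · exact Or.inr ⟨_, (isOption_smallNimber _ hn _).2 ⟨k, hk, rfl⟩, rfl⟩
    · exact Or.inl ⟨_, (isOption_smallNimber _ hn _).2 ⟨k, hk, rfl⟩, rfl⟩

theorem outcome_eq_P_iff (G : Game) : G.outcome = .P ↔ ∀ P, ¬ G.MoverWins P := by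
  unfold outcome
  constructor
  · intro h P
    cases P <;> split_ifs at h <;> assumption
  · intro h
    simp [h]

end Game

open Game

/-! ### Moves in a position -/

/-- The moves of a player on a single strip. -/
def StripMove : Player → Strip → Strip → Prop
  | .left => LeftMove
  | .right => RightMove

theorem StripMove.weight_lt {P : Player} {s t : Strip} (h : StripMove P s t) :
    weight t < weight s := by
  cases P
  · exact LeftMove.weight_lt h
  · exact RightMove.weight_lt h

theorem isOption_stripGame (P : Player) (s : Strip) (X : Game) :
    IsOption P (stripGame s) X ↔ ∃ t, StripMove P s t ∧ X = stripGame t := by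
  rw [stripGame]
  cases P <;> simp [IsOption, StripMove]

/-- The moves of a player on a position: a move on exactly one of the strips. -/
inductive PosMove (P : Player) : List Strip → List Strip → Prop
  | head {s t : Strip} (p : List Strip) (h : StripMove P s t) : PosMove P (s :: p) (t :: p)
  | tail (s : Strip) {p q : List Strip} (h : PosMove P p q) : PosMove P (s :: p) (s :: q)

theorem isOption_positionGame (P : Player) (p : List Strip) (X : Game) :
    IsOption P (positionGame p) X ↔ ∃ q, PosMove P p q ∧ X = positionGame q := by
  induction p generalizing X with
  | nil =>
    constructor
    · cases P <;> simp [positionGame, zero, IsOption]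
    · rintro ⟨q, ⟨⟩, -⟩
  | cons s p ih =>
    change IsOption P (stripGame s + positionGame p) X ↔ _
    rw [isOption_add]
    constructor
    · rintro (⟨H, hH, rfl⟩ | ⟨H, hH, rfl⟩)
      · obtain ⟨t, ht, rfl⟩ := (isOption_stripGame P s H).1 hH
        exact ⟨t :: p, .head p ht, rfl⟩
      · obtain ⟨q, hq, rfl⟩ := (ih H).1 hH
        exact ⟨s :: q, .tail s hq, rfl⟩
    · rintro ⟨q, hq, rfl⟩
      cases hq with
      | head _ h => exact Or.inl ⟨_, (isOption_stripGame P s _).2 ⟨_, h, rfl⟩, rfl⟩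
      | tail _ h => exact Or.inr ⟨_, (ih _).2 ⟨_, h, rfl⟩, rfl⟩

theorem PosMove.weight_lt {P : Player} {p q : List Strip} (h : PosMove P p q) :
    (q.map weight).sum < (p.map weight).sum := by
  induction h with
  | head p h => simpa using h.weight_lt
  | tail s h ih => simpa using ih

/-- `FirstWins P p n`: player `P` wins the sum of the position `p` and the nimber `n` when moving
first. -/
def FirstWins (P : Player) (p : List Strip) (n : ℕ) : Prop :=
  (positionGame p + smallNimber n).MoverWins P

theorem firstWins_iff (P : Player) (p : List Strip) {n : ℕ} (hn : n ≤ 2) :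
    FirstWins P p n ↔
      (∃ q, PosMove P p q ∧ ¬ FirstWins P.other q n) ∨ ∃ k < n, ¬ FirstWins P.other p k := by
  unfold FirstWins
  rw [moverWins_iff]
  constructor
  · rintro ⟨X, hX, hw⟩
    rcases (isOption_add _ _ _ _).1 hX with ⟨H, hH, rfl⟩ | ⟨H, hH, rfl⟩
    · obtain ⟨q, hq, rfl⟩ := (isOption_positionGame P p H).1 hH
      exact Or.inl ⟨q, hq, hw⟩
    · obtain ⟨k, hk, rfl⟩ := (isOption_smallNimber P hn H).1 hH
      exact Or.inr ⟨k, hk, hw⟩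
  · rintro (⟨q, hq, hw⟩ | ⟨k, hk, hw⟩)
    · exact ⟨_, (isOption_add _ _ _ _).2
        (Or.inl ⟨_, (isOption_positionGame P p _).2 ⟨q, hq, rfl⟩, rfl⟩), hw⟩
    · exact ⟨_, (isOption_add _ _ _ _).2
        (Or.inr ⟨_, (isOption_smallNimber P hn _).2 ⟨k, hk, rfl⟩, rfl⟩), hw⟩

/-! ### Rows and columns of a strip

A strip is the boundary path of a Young diagram, whose cells are the pairs of a black stone and a
white stone to its right. A Left move shortens a row and a Right move shortens a column. -/

/-- The colour change of a stone. -/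
def Stone.swap : Stone → Stone
  | .black => .white
  | .white => .black

@[simp] theorem Stone.swap_swap (c : Stone) : c.swap.swap = c := by
  cases c <;> rfl

theorem Stone.swap_injective : Function.Injective Stone.swap :=
  Function.LeftInverse.injective Stone.swap_swap

/-- Reversal of a strip together with a change of colours; this exchanges the two players. -/
def flip (s : Strip) : Strip := (s.map Stone.swap).reverse

@[simp] theorem flip_nil : flip [] = [] := rfl

@[simp] theorem flip_flip (s : Strip) : flip (flip s) = s := by
  simp [flip, Function.comp_def]

@[simp] theorem flip_append (s t : Strip) : flip (s ++ t) = flip t ++ flip s := by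
  simp [flip]

@[simp] theorem flip_cons (c : Stone) (s : Strip) : flip (c :: s) = flip s ++ [c.swap] := by
  simp [flip]

theorem swap_mem_flip (c : Stone) (s : Strip) : c.swap ∈ flip s ↔ c ∈ s := by
  simp [flip, Stone.swap_injective.eq_iff]

@[simp] theorem black_mem_flip (s : Strip) : .black ∈ flip s ↔ .white ∈ s :=
  swap_mem_flip .white s

@[simp] theorem white_mem_flip (s : Strip) : .white ∈ flip s ↔ .black ∈ s :=
  swap_mem_flip .black s

theorem rightMove_flip {s t : Strip} (h : LeftMove s t) : RightMove (flip s) (flip t) := by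
  obtain ⟨u, m, v, hm, rfl, rfl⟩ := h
  exact ⟨flip v, flip m, flip u, by simpa using hm, by simp [Stone.swap], by simp [Stone.swap]⟩

/-- The number of white stones of a strip. -/
def whites : Strip → ℕ
  | [] => 0
  | .black :: s => whites s
  | .white :: s => whites s + 1

@[simp] theorem whites_append (s t : Strip) : whites (s ++ t) = whites s + whites t := by
  induction s with
  | nil => simp [whites]
  | cons c s ih => cases c <;> simp [whites, ih]; omega

theorem whites_eq_zero {s : Strip} : whites s = 0 ↔ .white ∉ s := by
  induction s with
  | nil => simp [whites]
  | cons c s ih => cases c <;> simp [whites, ih]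

/-- The number of columns of a strip: its white stones with a black stone to their left. -/
def columns : Strip → ℕ
  | [] => 0
  | .black :: s => whites s
  | .white :: s => columns s

/-- The number of rows of a strip: its black stones with a white stone to their right. -/
def rows (s : Strip) : ℕ := columns (flip s)

theorem columns_append_of_mem {s : Strip} (h : .black ∈ s) (t : Strip) :
    columns (s ++ t) = columns s + whites t := by
  induction s with
  | nil => simp at h
  | cons c s ih =>
    cases c
    · simp [columns]
    · simpa [columns] using ih (by simpa using h)

theorem columns_append_of_notMem {s : Strip} (h : .black ∉ s) (t : Strip) :
    columns (s ++ t) = columns t := by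
  induction s with
  | nil => rfl
  | cons c s ih =>
    cases c
    · simp at h
    · simpa [columns] using ih (by simpa using h)

theorem columns_eq_zero_of_notMem_black {s : Strip} (h : .black ∉ s) : columns s = 0 := by
  simpa [columns] using columns_append_of_notMem h []

theorem columns_le_whites (s : Strip) : columns s ≤ whites s := by
  induction s with
  | nil => simp [columns]
  | cons c s ih => cases c <;> simp [columns, whites]; omega

theorem columns_pos (u m v : Strip) : 0 < columns (u ++ .black :: (m ++ .white :: v)) := by
  by_cases h : .black ∈ u
  · rw [columns_append_of_mem h]; simp [whites]
  · rw [columns_append_of_notMem h]; simp [columns, whites]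

theorem exists_of_columns_pos {s : Strip} (h : 0 < columns s) :
    ∃ u m v : Strip, .black ∉ u ∧ s = u ++ .black :: (m ++ .white :: v) := by
  induction s with
  | nil => simp [columns] at h
  | cons c s ih =>
    cases c
    · have hw : .white ∈ s := by
        by_contra hw
        rw [← whites_eq_zero] at hw
        simp [columns, hw] at h
      obtain ⟨m, v, rfl⟩ := List.append_of_mem hw
      exact ⟨[], m, v, by simp, rfl⟩
    · obtain ⟨u, m, v, hu, rfl⟩ := ih h
      exact ⟨.white :: u, m, v, by simpa using hu, rfl⟩

theorem rows_pos_of_columns_pos {s : Strip} (h : 0 < columns s) : 0 < rows s := by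
  obtain ⟨u, m, v, -, rfl⟩ := exists_of_columns_pos h
  have := columns_pos (flip v) (flip m) (flip u)
  simpa [rows, Stone.swap] using this

theorem whites_flip_eq_zero {s : Strip} : whites (flip s) = 0 ↔ .black ∉ s := by
  rw [whites_eq_zero, white_mem_flip]

/-- `whites (flip s)` counts the black stones of `s`; a white stone in `t` turns each of them into a
row. -/
theorem rows_append_of_mem (s : Strip) {t : Strip} (h : .white ∈ t) :
    rows (s ++ t) = whites (flip s) + rows t := by
  rw [rows, flip_append, columns_append_of_mem (by simpa using h), rows, add_comm]

theorem rows_append_of_notMem (s : Strip) {t : Strip} (h : .white ∉ t) :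
    rows (s ++ t) = rows s := by
  rw [rows, flip_append, columns_append_of_notMem (by simpa using h), rows]

theorem rows_white_cons (s : Strip) : rows (.white :: s) = rows s := by
  by_cases h : .white ∈ s
  · simpa [flip, whites, Stone.swap] using rows_append_of_mem [.white] h
  · rw [rows, rows, columns_eq_zero_of_notMem_black (s := flip s) (by simpa using h), flip_cons,
      columns_append_of_notMem (by simpa using h)]
    simp [columns, whites, Stone.swap]

theorem rows_before_swap (u m v : Strip) :
    rows (u ++ .black :: (m ++ .white :: v)) =
      whites (flip u) + 1 + whites (flip m) + rows v := by
  have h := rows_append_of_mem (u ++ .black :: m) (t := .white :: v) (by simp)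
  rw [rows_white_cons] at h
  simp [whites, Stone.swap] at h
  rw [h]
  omega

theorem rows_after_swap_of_mem (u m : Strip) {v : Strip} (h : .white ∈ v) :
    rows (u ++ .white :: (m ++ .black :: v)) =
      whites (flip u) + 1 + whites (flip m) + rows v := by
  have h := rows_append_of_mem (u ++ .white :: (m ++ [.black])) h
  simp [whites, Stone.swap] at h
  rw [h]
  omega

/-- The moved black stone has no white stone left to its right, so its row vanishes; a black stone
of `m` keeps its row only through a white stone of `m`. -/
theorem rows_after_swap_of_notMem (u m : Strip) {v : Strip} (h : .white ∉ v) :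
    rows (u ++ .white :: (m ++ .black :: v)) = whites (flip u) + rows m := by
  have h := rows_append_of_notMem (u ++ .white :: m) (t := .black :: v) (by simpa using h)
  rw [rows_append_of_mem u (by simp), rows_white_cons] at h
  simpa using h

theorem rows_swap_le (u m v : Strip) :
    rows (u ++ .white :: (m ++ .black :: v)) ≤ rows (u ++ .black :: (m ++ .white :: v)) := by
  rw [rows_before_swap]
  by_cases h : .white ∈ v
  · rw [rows_after_swap_of_mem u m h]
  · rw [rows_after_swap_of_notMem u m h]
    have : rows m ≤ whites (flip m) := columns_le_whites _
    omega

theorem columns_swap_of_mem {u : Strip} (h : .black ∈ u) (m v : Strip) :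
    columns (u ++ .white :: (m ++ .black :: v)) =
      columns (u ++ .black :: (m ++ .white :: v)) := by
  rw [columns_append_of_mem h, columns_append_of_mem h]
  simp [whites]
  omega

/-- A black stone in `u` keeps every column nonempty, but then there are at least two rows.
Otherwise the moved white stone passes every black stone to its left, and exactly its column
disappears. -/
theorem rightMove_columns {s t : Strip} (h : RightMove s t) :
    rows t ≤ rows s ∧ columns s ≤ columns t + 1 ∧
      (rows s ≤ 1 → columns t + 1 = columns s) := by
  obtain ⟨u, m, v, hm, rfl, rfl⟩ := h
  refine ⟨rows_swap_le u m v, ?_⟩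
  by_cases hu : .black ∈ u
  · refine ⟨by rw [columns_swap_of_mem hu]; omega, fun h => ?_⟩
    have := mt whites_flip_eq_zero.1 (not_not.2 hu)
    rw [rows_before_swap] at h
    omega
  · have hw := whites_eq_zero.2 hm
    have hc := columns_le_whites m
    have : columns (m ++ .black :: v) = whites v := by
      by_cases hb : .black ∈ m
      · rw [columns_append_of_mem hb]; simp only [whites]; omega
      · rw [columns_append_of_notMem hb]; rfl
    rw [columns_append_of_notMem hu, columns_append_of_notMem hu]
    simp [columns, whites, this]
    omega

/-- The last black stone with a white stone to its right gives the shortest row, of length `k + 1`.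
-/
theorem exists_last_row {s : Strip} (h : 0 < rows s) :
    ∃ u v : Strip, ∃ k : ℕ, .white ∉ v ∧
      s = u ++ .black :: (List.replicate k .white ++ .white :: v) := by
  obtain ⟨u, m, v, hu, hs⟩ := exists_of_columns_pos h
  obtain ⟨a, b, hb, hab⟩ : ∃ a b : Strip, .black ∉ b ∧
      flip v ++ .black :: flip m = a ++ .black :: b := by
    obtain ⟨b, a, hx, hb⟩ := List.eq_append_cons_of_mem
      (a := Stone.white) (xs := m ++ .white :: v) (by simp)
    refine ⟨flip a, flip b, by simpa using hb, ?_⟩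
    simpa [Stone.swap] using congrArg flip hx
  refine ⟨a, flip u, b.length, by simpa using hu, ?_⟩
  have hs' := congrArg flip hs
  rw [← List.eq_replicate_of_mem (l := b) (a := .white) ?_]
  · rw [← List.cons_append, ← List.append_assoc, ← hab]
    simpa [Stone.swap] using hs'
  · rintro (_ | _) hc
    · exact absurd hc hb
    · rfl

/-- Moving that black stone past all remaining white stones deletes the shortest row; a longer or
equal row above it keeps all the columns. -/
theorem exists_leftMove_of_two_le_rows {s : Strip} (h : 2 ≤ rows s) :
    ∃ t, LeftMove s t ∧ rows t + 1 = rows s ∧ columns t = columns s := by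
  obtain ⟨u, v, k, hv, rfl⟩ := exists_last_row (by omega : 0 < rows s)
  have hk : Stone.black ∉ List.replicate k Stone.white := by simp [List.mem_replicate]
  have hk' := whites_flip_eq_zero.2 hk
  have hr : rows (List.replicate k .white) = 0 :=
    Nat.le_zero.1 ((columns_le_whites _).trans_eq hk')
  have hv' : rows v = 0 := columns_eq_zero_of_notMem_black (by simpa using hv)
  refine ⟨_, ⟨u, _, v, hk, rfl, rfl⟩, ?_, columns_swap_of_mem ?_ _ _⟩
  · rw [rows_after_swap_of_notMem u _ hv, rows_before_swap]
    omega
  · rw [rows_before_swap] at h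
    by_contra hu
    have := whites_flip_eq_zero.2 hu
    omega

theorem exists_leftMove_of_rows_le_one {s : Strip} (h : rows s ≤ 1) {j : ℕ}
    (hj : j + 1 ≤ columns s) :
    ∃ t, LeftMove s t ∧ rows t ≤ 1 ∧ columns t + (j + 1) = columns s := by
  have hpos : 0 < columns s := by omega
  obtain ⟨u, v, k, hv, rfl⟩ := exists_last_row (rows_pos_of_columns_pos hpos)
  have hu : .black ∉ u := by
    rw [rows_before_swap] at h
    rw [← whites_flip_eq_zero]
    omega
  have hw (n : ℕ) : whites (List.replicate n .white) = n := by
    induction n with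
    | zero => rfl
    | succ n ih => simp [List.replicate_succ, whites, ih]
  have hc : columns (u ++ .black :: (List.replicate k .white ++ .white :: v)) = k + 1 := by
    rw [columns_append_of_notMem hu]
    simp [columns, whites, hw, whites_eq_zero.2 hv]
  -- The single row has `k + 1` cells: `j + 1` are removed and `k - j` remain.
  have hs : List.replicate k .white ++ .white :: v =
      List.replicate j .white ++ .white :: (List.replicate (k - j) .white ++ v) := by
    rw [List.append_cons, ← List.replicate_succ', ← List.cons_append, ← List.replicate_succ,
      ← List.append_assoc, List.replicate_append_replicate]
    congr 2
    omega
  refine ⟨_, ⟨u, _, _, ?_, congrArg (fun x => u ++ .black :: x) hs, rfl⟩, ?_, ?_⟩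
  · simp [List.mem_replicate]
  · rw [hs] at h
    exact (rows_swap_le _ _ _).trans h
  · have hk : Stone.black ∉ List.replicate j Stone.white := by simp [List.mem_replicate]
    rw [hc, columns_append_of_notMem hu, columns, columns_append_of_notMem hk]
    simp [columns, hw, whites_eq_zero.2 hv]
    omega

/-- The number of rows for Left, of columns for Right: the lines that the player shortens. -/
def lines : Player → Strip → ℕ
  | .left => rows
  | .right => columns

theorem rows_flip (s : Strip) : rows (flip s) = columns s := by
  rw [rows, flip_flip]

theorem lines_of_opponent_move {P : Player} {s t : Strip} (h : StripMove P.other s t) :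
    lines P t ≤ lines P s ∧ lines P.other s ≤ lines P.other t + 1 ∧
      (lines P s ≤ 1 → lines P.other t + 1 = lines P.other s) := by
  cases P
  · exact rightMove_columns h
  · simpa [rows_flip, lines, Player.other, rows] using rightMove_columns (rightMove_flip h)

theorem exists_move_of_two_le_lines {P : Player} {s : Strip} (h : 2 ≤ lines P s) :
    ∃ t, StripMove P s t ∧ lines P t + 1 = lines P s ∧ lines P.other t = lines P.other s := by
  cases P
  · exact exists_leftMove_of_two_le_rows h
  · obtain ⟨t, ht, h1, h2⟩ :=
      exists_leftMove_of_two_le_rows (s := flip s) (by rwa [rows_flip])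
    refine ⟨flip t, by simpa [StripMove] using rightMove_flip ht, ?_⟩
    rw [rows_flip] at h1
    exact ⟨h1, (rows_flip t).trans h2⟩

theorem exists_move_of_lines_le_one {P : Player} {s : Strip} (h : lines P s ≤ 1) {j : ℕ}
    (hj : j + 1 ≤ lines P.other s) :
    ∃ t, StripMove P s t ∧ lines P t ≤ 1 ∧ lines P.other t + (j + 1) = lines P.other s := by
  cases P
  · exact exists_leftMove_of_rows_le_one h hj
  · obtain ⟨t, ht, h1, h2⟩ :=
      exists_leftMove_of_rows_le_one (s := flip s) (by rwa [rows_flip]) hj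
    exact ⟨flip t, by simpa [StripMove] using rightMove_flip ht, h1,
      by simpa [lines, Player.other, rows] using h2⟩

theorem lines_other_eq_zero {P : Player} {s : Strip} (h : lines P s = 0) :
    lines P.other s = 0 := by
  by_contra h'
  cases P
  · exact (rows_pos_of_columns_pos (Nat.pos_of_ne_zero h')).ne' h
  · have := rows_pos_of_columns_pos (Nat.pos_of_ne_zero h')
    rw [rows_flip] at this
    exact this.ne' h

/-! ### Rows and columns of a position -/

/-- The number of lines in all the strips of a position. -/
def totalLines (P : Player) (p : List Strip) : ℕ := (p.map (lines P)).sum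

@[simp] theorem totalLines_cons (P : Player) (s : Strip) (p : List Strip) :
    totalLines P (s :: p) = lines P s + totalLines P p := by
  simp [totalLines]

/-- A position is thin for a player if every strip has at most one line of that player. -/
def Thin (P : Player) (p : List Strip) : Prop := ∀ s ∈ p, lines P s ≤ 1

@[simp] theorem thin_cons (P : Player) (s : Strip) (p : List Strip) :
    Thin P (s :: p) ↔ lines P s ≤ 1 ∧ Thin P p := by
  simp [Thin]

theorem PosMove.totalLines_le {P : Player} {p q : List Strip} (h : PosMove P.other p q) :
    totalLines P q ≤ totalLines P p ∧ totalLines P.other p ≤ totalLines P.other q + 1 := by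
  induction h with
  | head p h =>
    have := lines_of_opponent_move h
    simp only [totalLines_cons]
    omega
  | tail s h ih =>
    simp only [totalLines_cons]
    omega

theorem PosMove.thin {P : Player} {p q : List Strip} (h : PosMove P.other p q) (hp : Thin P p) :
    Thin P q ∧ totalLines P.other q + 1 = totalLines P.other p := by
  induction h with
  | head p h =>
    obtain ⟨h1, -, h2⟩ := lines_of_opponent_move h
    rw [thin_cons] at hp
    have := h2 hp.1
    simp only [totalLines_cons, thin_cons]
    exact ⟨⟨h1.trans hp.1, hp.2⟩, by omega⟩
  | tail s h ih =>
    rw [thin_cons] at hp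
    obtain ⟨h1, h2⟩ := ih hp.2
    simp only [totalLines_cons, thin_cons]
    exact ⟨⟨hp.1, h1⟩, by omega⟩

theorem exists_posMove_of_not_thin {P : Player} {p : List Strip} (hp : ¬ Thin P p) :
    ∃ q, PosMove P p q ∧ totalLines P q + 1 = totalLines P p ∧
      totalLines P.other q = totalLines P.other p := by
  induction p with
  | nil => simp [Thin] at hp
  | cons s p ih =>
    by_cases hs : lines P s ≤ 1
    · obtain ⟨q, hq, h1, h2⟩ := ih (by simpa [hs] using hp)
      refine ⟨_, .tail s hq, ?_, ?_⟩ <;> simp only [totalLines_cons] <;> omega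
    · obtain ⟨t, ht, h1, h2⟩ := exists_move_of_two_le_lines (by omega : 2 ≤ lines P s)
      refine ⟨_, .head p ht, ?_, ?_⟩ <;> simp only [totalLines_cons] <;> omega

theorem Thin.exists_posMove {P : Player} {p : List Strip} (hp : Thin P p) {j : ℕ}
    (hj : ∃ s ∈ p, j + 1 ≤ lines P.other s) :
    ∃ q, PosMove P p q ∧ Thin P q ∧ totalLines P.other q + (j + 1) = totalLines P.other p := by
  induction p with
  | nil => simp at hj
  | cons s p ih =>
    rw [thin_cons] at hp
    by_cases hs : j + 1 ≤ lines P.other s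
    · obtain ⟨t, ht, h1, h2⟩ := exists_move_of_lines_le_one hp.1 hs
      refine ⟨_, .head p ht, by simp [h1, hp.2], ?_⟩
      simp only [totalLines_cons]
      omega
    · obtain ⟨q, hq, h1, h2⟩ := ih hp.2
        (by simpa only [List.exists_mem_cons_iff, hs, false_or] using hj)
      refine ⟨_, .tail s hq, by simp [h1, hp.1], ?_⟩
      simp only [totalLines_cons]
      omega

/-! ### Strategies -/

/-- In a position that is thin for `P`, with an even number of cells (counting one for `*`), `P`
wins moving second. -/
theorem Thin.not_firstWins_other {P : Player} {p : List Strip} (hp : Thin P p) {n : ℕ}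
    (hn : n ≤ 1) (h : Even (totalLines P.other p + n)) : ¬ FirstWins P.other p n := by
  induction hN : totalLines P.other p + n using Nat.strong_induction_on generalizing p n with
  | _ N ih =>
    subst hN
    -- Each move of the opponent makes the count odd. If no `*` is left, some cell exists and `P`
    -- removes one; otherwise `P` moves `*` to `0`.
    have reply : ∀ q m, Thin P q → m ≤ 1 →
        totalLines P.other q + m + 1 = totalLines P.other p + n → FirstWins P q m := by
      intro q m hq hm hqm
      rw [firstWins_iff P q (by omega)]
      rw [Nat.even_iff] at h
      by_cases h0 : m = 0
      · subst h0
        have : ∃ s ∈ q, 0 + 1 ≤ lines P.other s := by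
          by_contra! hcon
          have : totalLines P.other q = 0 := by
            rw [totalLines, List.sum_eq_zero_iff]
            intro x hx
            obtain ⟨s, hs, rfl⟩ := List.mem_map.1 hx
            have := hcon s hs
            omega
          omega
        obtain ⟨r, hr, h1, h2⟩ := hq.exists_posMove this
        refine Or.inl ⟨r, hr, ih _ ?_ h1 (by omega) ?_ rfl⟩
        · omega
        · rw [Nat.even_iff]; omega
      · refine Or.inr ⟨0, by omega, ih _ ?_ hq (by omega) ?_ rfl⟩
        · omega
        · rw [Nat.even_iff]; omega
    rw [firstWins_iff _ _ (by omega), Player.other_other]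
    rintro (⟨q, hq, hw⟩ | ⟨k, hk, hw⟩)
    · obtain ⟨h1, h2⟩ := hq.thin hp
      exact hw (reply q n h1 hn (by omega))
    · exact hw (reply p k hp (by omega) (by omega))

/-- `P` replaces `*2` by `0` or `*`, whichever makes the count even. -/
theorem Thin.firstWins_two {P : Player} {p : List Strip} (hp : Thin P p) : FirstWins P p 2 := by
  rw [firstWins_iff P p le_rfl]
  refine Or.inr ⟨totalLines P.other p % 2, by omega, hp.not_firstWins_other (by omega) ?_⟩
  rw [Nat.even_iff]
  omega

theorem Thin.firstWins_of_lt {P : Player} {p : List Strip} (hp : Thin P p) {n : ℕ} (hn : n ≤ 1)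
    (h : totalLines P p < totalLines P.other p) : FirstWins P p n := by
  obtain ⟨s, hs, hlt⟩ : ∃ s ∈ p, lines P s < lines P.other s := by
    by_contra! hcon
    exact h.not_ge (List.sum_le_sum hcon)
  -- If `s` had just one line for the opponent, it would have none for `P`, hence no cell at all.
  have h2 : 2 ≤ lines P.other s := by
    by_contra h2
    have := lines_other_eq_zero (P := P) (s := s) (by omega)
    omega
  -- Removing one or two cells allows either parity.
  obtain ⟨j, hj, hjn⟩ : ∃ j ≤ 1, Even (totalLines P.other p - (j + 1) + n) := by
    refine ⟨(totalLines P.other p + n + 1) % 2, by omega, ?_⟩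
    have : lines P.other s ≤ totalLines P.other p :=
      List.single_le_sum (by simp) _ (List.mem_map_of_mem hs)
    rw [Nat.even_iff]
    omega
  obtain ⟨q, hq, h3, h4⟩ := hp.exists_posMove (j := j) ⟨s, hs, by omega⟩
  rw [firstWins_iff P p (by omega)]
  refine Or.inl ⟨q, hq, h3.not_firstWins_other hn ?_⟩
  rwa [← h4, Nat.add_sub_cancel] at hjn

/-- The lead in lines with which a player wins moving second, in the presence of the nimber `n`. -/
def requiredLead (n : ℕ) : ℕ := if n = 2 then 1 else 2

/-- Moving first, `P` needs one less lead than moving second. The induction measure includes `n`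
because a nimber move leaves the strips unchanged. -/
theorem wins_of_lead (P : Player) (p : List Strip) {n : ℕ} (hn : n ≤ 2) :
    (totalLines P p + requiredLead n ≤ totalLines P.other p → ¬ FirstWins P.other p n) ∧
      (totalLines P p + requiredLead n ≤ totalLines P.other p + 1 → FirstWins P p n) := by
  induction hN : (p.map weight).sum + n using Nat.strong_induction_on generalizing p n with
  | _ N ih =>
    subst hN
    constructor
    · intro h
      rw [firstWins_iff _ _ hn, Player.other_other]
      rintro (⟨q, hq, hw⟩ | ⟨k, hk, hw⟩)
      · have := hq.weight_lt
        have := hq.totalLines_le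
        exact hw ((ih _ (by omega) q hn rfl).2 (by omega))
      -- Lowering the nimber raises the required lead by at most one, which having the move offsets.
      · refine hw ((ih _ (by omega) p (by omega) rfl).2 ?_)
        unfold requiredLead at *
        split_ifs at * <;> omega
    · intro h
      by_cases hp : Thin P p
      · by_cases h2 : n = 2
        · subst h2
          exact hp.firstWins_two
        · rw [requiredLead, if_neg h2] at h
          exact hp.firstWins_of_lt (by omega) (by omega)
      · obtain ⟨q, hq, h1, h2⟩ := exists_posMove_of_not_thin hp
        have := hq.weight_lt
        rw [firstWins_iff _ _ hn]
        exact Or.inl ⟨q, hq, (ih _ (by omega) q hn rfl).1 (by omega)⟩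

theorem firstWins_two_of_le {P : Player} {p : List Strip}
    (h : totalLines P p ≤ totalLines P.other p) : FirstWins P p 2 :=
  (wins_of_lead P p le_rfl).2 (by simpa [requiredLead] using h)

end Bipass

theorem mainTheorem5 (p : List Bipass.Strip) :
    ¬ Bipass.Game.Equivalent (Bipass.positionGame p) Bipass.Game.starTwo := by
  intro h
  have hP : (Bipass.positionGame p + Bipass.Game.starTwo).outcome = .P :=
    (h Bipass.Game.starTwo).trans ((Bipass.Game.outcome_eq_P_iff _).2 fun P =>
      Bipass.Game.not_moverWins_smallNimber_add_self P le_rfl)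
  rw [Bipass.Game.outcome_eq_P_iff] at hP
  rcases le_total (Bipass.totalLines .left p) (Bipass.totalLines .right p) with hle | hle
  · exact hP .left (Bipass.firstWins_two_of_le hle)
  · exact hP .right (Bipass.firstWins_two_of_le hle)
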